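/- Let $\bar M$ be a saturated first-order structure in a language $L$, with $|\bar M|>|L|+\aleph_0$; "small" means of cardinality less than $|\bar M|$. A set of $n$-tuples is type-definable over $A\subseteq \bar M$ if it is an intersection of $A$-definable sets. Let $G\subseteq \bar M^n$ be a definable group or, more generally, a type-definable group, i.e. the set $G$ and the graph of its multiplication are type-definable over a small set of parameters. By a definable subset of $G$ we mean the intersection of $G$ with a subset of $\bar M^n$ that is definable with parameters; such a set is called $A$-definable if the parameters can be taken in $A$. Suppose that $G$ is compactly dominated: there are a compact Hausdorff group $H$ with normalized Haar measure $\mathbf m$ and a surjective group homomorphism $\pi:G\to H$ such that (a) there is a small set $A$ such that $\pi^{-1}(D)$ is type-definable over $A$ for every closed $D\subseteq H$, and (b) for every definable $Y\subseteq G$, $\mathbf m(\{h\in H:\pi^{-1}(h)\cap Y\neq\emptyset\text{ and }\pi^{-1}(h)\cap(G\setminus Y)\neq\emptyset\})=0$. A (global) Keisler measure on $G$ is a finitely additive probability measure on the Boolean algebra of definable subsets of $G$. Then $G$ has exactly one left-invariant Keisler measure $\mu$. Moreover, $\mu$ is right-invariant, and $\mu$ is smooth: there is a small elementary substructure $M_0\prec\bar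 M$, over which $G$ is type-definable, such that $\mu$ is the only Keisler measure on $G$ that agrees with $\mu$ on all $M_0$-definable subsets of $G$. -/

import Mathlib

universe u v w z

namespace CompactDomination

section Model

variable (L : FirstOrder.Language.{u, v}) (M : Type w) [L.Structure M]

/-- `M` is saturated: for every parameter set `A` with `|A| < |M|`, every finitely satisfiable
family of formulas over `A` in one variable (given by the `A`-definable subsets of `M` that they
define) is realized in `M`. -/
def IsSaturated : Prop :=
  ∀ A : Set M, Cardinal.mk A < Cardinal.mk M →
    ∀ F : Set (Set M), (∀ Y ∈ F, A.Definable₁ L Y) →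
      (∀ F₀ : Finset (Set M), (F₀ : Set (Set M)) ⊆ F → (⋂₀ (F₀ : Set (Set M))).Nonempty) →
      (⋂₀ F).Nonempty

/-- A large saturated model: a saturated structure whose cardinality exceeds `|L| + ℵ₀`. -/
structure IsLargeSaturated : Prop where
  aleph0_lt : Cardinal.aleph0 < Cardinal.mk M
  card_language_lt : Cardinal.lift.{w} L.card < Cardinal.lift.{max u v} (Cardinal.mk M)
  saturated : IsSaturated L M

variable {M}

/-- A set of parameters (or of anything else inside `M`) is small if it has fewer than `|M|`
elements. -/
def IsSmall (A : Set M) : Prop :=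
  Cardinal.mk A < Cardinal.mk M

/-- `X` is type-definable over `A`: an intersection of `A`-definable sets. In a large saturated
model, for small `A`, there are only a small number of `A`-definable sets, so this is the
intersection of a small collection. -/
def TypeDefinableOver (A : Set M) {α : Type*} (X : Set (α → M)) : Prop :=
  ∃ F : Set (Set (α → M)), (∀ Y ∈ F, A.Definable L Y) ∧ X = ⋂₀ F

/-- `Y` is a relatively definable subset of `X`, with parameters from `A`. -/
def RelDefinable {n : ℕ} {X : Set (Fin n → M)} (A : Set M) (Y : Set X) : Prop :=
  ∃ D : Set (Fin n → M), A.Definable L D ∧ Y = Subtype.val ⁻¹' D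

variable {L}

theorem RelDefinable.empty {n : ℕ} {X : Set (Fin n → M)} (A : Set M) :
    RelDefinable L A (∅ : Set X) :=
  ⟨∅, Set.definable_empty, by simp⟩

theorem RelDefinable.univ {n : ℕ} {X : Set (Fin n → M)} (A : Set M) :
    RelDefinable L A (Set.univ : Set X) :=
  ⟨Set.univ, Set.definable_univ, by simp⟩

theorem RelDefinable.union {n : ℕ} {X : Set (Fin n → M)} {A : Set M} {Y Z : Set X}
    (hY : RelDefinable L A Y) (hZ : RelDefinable L A Z) : RelDefinable L A (Y ∪ Z) := by
  obtain ⟨D, hD, rfl⟩ := hY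
  obtain ⟨E, hE, rfl⟩ := hZ
  exact ⟨D ∪ E, hD.union hE, rfl⟩

theorem RelDefinable.inter {n : ℕ} {X : Set (Fin n → M)} {A : Set M} {Y Z : Set X}
    (hY : RelDefinable L A Y) (hZ : RelDefinable L A Z) : RelDefinable L A (Y ∩ Z) := by
  obtain ⟨D, hD, rfl⟩ := hY
  obtain ⟨E, hE, rfl⟩ := hZ
  exact ⟨D ∩ E, hD.inter hE, rfl⟩

theorem RelDefinable.mono {n : ℕ} {X : Set (Fin n → M)} {A B : Set M} {Y : Set X}
    (hY : RelDefinable L A Y) (h : A ⊆ B) : RelDefinable L B Y := by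
  obtain ⟨D, hD, rfl⟩ := hY
  exact ⟨D, hD.mono h, rfl⟩

end Model

section Groups

variable (L : FirstOrder.Language.{u, v}) {M : Type w} [L.Structure M]

/-- The graph of the multiplication of a group whose underlying set is a set of `n`-tuples. -/
def mulGraph {n : ℕ} (G : Set (Fin n → M)) [Group G] : Set (Fin n ⊕ Fin n ⊕ Fin n → M) :=
  {t | ∃ x y : G, t = Sum.elim x.val (Sum.elim y.val (x * y).val)}

/-- `G` is a type-definable group: its underlying set and the graph of its multiplication are
type-definable over a small set of parameters. Every definable group is one. -/
def IsTypeDefinableGroup {n : ℕ} (G : Set (Fin n → M)) [Group G] : Prop :=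
  ∃ A : Set M, IsSmall A ∧ TypeDefinableOver L A G ∧ TypeDefinableOver L A (mulGraph G)

end Groups

section Keisler

variable (L : FirstOrder.Language.{u, v}) {M : Type w} [L.Structure M] {n : ℕ}

/-- A Keisler measure on `X` over `A`: a finitely additive probability measure on the Boolean
algebra of subsets of `X` that are (relatively) definable over `A`. -/
structure KeislerMeasure (X : Set (Fin n → M)) (A : Set M) where
  toFun : {Y : Set X // RelDefinable L A Y} → ℝ
  mem_Icc : ∀ Y, toFun Y ∈ Set.Icc (0 : ℝ) 1
  empty : toFun ⟨∅, RelDefinable.empty A⟩ = 0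
  univ : toFun ⟨Set.univ, RelDefinable.univ A⟩ = 1
  union : ∀ Y Z : {Y : Set X // RelDefinable L A Y},
    toFun ⟨Y.1 ∪ Z.1, Y.2.union Z.2⟩ =
      toFun Y + toFun Z - toFun ⟨Y.1 ∩ Z.1, Y.2.inter Z.2⟩

/-- A global Keisler measure on `X`: a measure of all subsets of `X` definable with parameters
in `M`. -/
abbrev GlobalKeislerMeasure (X : Set (Fin n → M)) :=
  KeislerMeasure L X (Set.univ : Set M)

variable {L}

/-- The restriction `μ|A` of a Keisler measure over `B` to a smaller set of parameters `A`. -/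
def KeislerMeasure.restrict {X : Set (Fin n → M)} {B : Set M} (μ : KeislerMeasure L X B)
    {A : Set M} (h : A ⊆ B) : KeislerMeasure L X A where
  toFun Y := μ.toFun ⟨Y.1, Y.2.mono h⟩
  mem_Icc _ := μ.mem_Icc _
  empty := μ.empty
  univ := μ.univ
  union Y Z := μ.union ⟨Y.1, Y.2.mono h⟩ ⟨Z.1, Z.2.mono h⟩

/-- `μ` is smooth over `A`: it is the only global Keisler measure on `X` that extends `μ|A`. -/
def KeislerMeasure.IsSmoothOver {X : Set (Fin n → M)} (μ : GlobalKeislerMeasure L X)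
    (A : Set M) : Prop :=
  ∀ ν : GlobalKeislerMeasure L X,
    ν.restrict (Set.subset_univ A) = μ.restrict (Set.subset_univ A) → ν = μ

/-- `μ` is smooth: it is smooth over some small elementary substructure over which `X` is
type-definable. -/
def KeislerMeasure.IsSmooth {X : Set (Fin n → M)} (μ : GlobalKeislerMeasure L X) : Prop :=
  ∃ M₀ : L.ElementarySubstructure M, IsSmall (M₀ : Set M) ∧
    TypeDefinableOver L (M₀ : Set M) X ∧ μ.IsSmoothOver (M₀ : Set M)

/-- `μ (gY) = μ Y` for all `g` in `G` and all definable subsets `Y` of `G`. -/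
def KeislerMeasure.IsLeftInvariant {G : Set (Fin n → M)} [Group G]
    (μ : GlobalKeislerMeasure L G) : Prop :=
  ∀ (g : G) (Y Z : {Y : Set G // RelDefinable L (Set.univ : Set M) Y}),
    Z.1 = (fun x => g * x) '' Y.1 → μ.toFun Z = μ.toFun Y

/-- `μ (Yg) = μ Y` for all `g` in `G` and all definable subsets `Y` of `G`. -/
def KeislerMeasure.IsRightInvariant {G : Set (Fin n → M)} [Group G]
    (μ : GlobalKeislerMeasure L G) : Prop :=
  ∀ (g : G) (Y Z : {Y : Set G // RelDefinable L (Set.univ : Set M) Y}),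
    Z.1 = (fun x => x * g) '' Y.1 → μ.toFun Z = μ.toFun Y

end Keisler

section Domination

variable (L : FirstOrder.Language.{u, v}) {M : Type w} [L.Structure M] {n : ℕ}

/-- A map `f : X → C` to a compact space is definable if, for some small `A`, the preimage of every
closed set is type-definable over `A`. (For the closed set `C` this says that `X` itself is
type-definable over `A`.) -/
def IsDefinableMap {X : Set (Fin n → M)} {C : Type z} [TopologicalSpace C] (f : X → C) : Prop :=
  ∃ A : Set M, IsSmall A ∧
    ∀ D : Set C, IsClosed D → TypeDefinableOver L A (Subtype.val '' (f ⁻¹' D))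

/-- `X` is compactly dominated by `(C, μ, f)`. -/
structure IsCompactlyDominated (X : Set (Fin n → M)) {C : Type z} [TopologicalSpace C]
    [CompactSpace C] [T2Space C] [MeasurableSpace C] [BorelSpace C]
    (μ : MeasureTheory.Measure C) [MeasureTheory.IsProbabilityMeasure μ] (f : X → C) : Prop where
  surjective : Function.Surjective f
  definable : IsDefinableMap L f
  null : ∀ Y : Set X, RelDefinable L (Set.univ : Set M) Y →
    μ {c | (f ⁻¹' {c} ∩ Y).Nonempty ∧ (f ⁻¹' {c} ∩ Yᶜ).Nonempty} = 0

/-- The normalized Haar measure of a compact Hausdorff group. -/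
noncomputable def normalizedHaar (H : Type z) [Group H] [TopologicalSpace H]
    [IsTopologicalGroup H] [CompactSpace H] [MeasurableSpace H] [BorelSpace H] :
    MeasureTheory.Measure H :=
  MeasureTheory.Measure.haarMeasure (⊤ : TopologicalSpace.PositiveCompacts H)

instance (H : Type z) [Group H] [TopologicalSpace H] [IsTopologicalGroup H] [CompactSpace H]
    [MeasurableSpace H] [BorelSpace H] :
    MeasureTheory.IsProbabilityMeasure (normalizedHaar H) :=
  ⟨MeasureTheory.Measure.haarMeasure_self (K₀ := (⊤ : TopologicalSpace.PositiveCompacts H))⟩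

/-- The group `G` is compactly dominated, as a group, by the compact group `H` with its normalized
Haar measure, via the homomorphism `π`. -/
def IsCompactlyDominatedGroup (G : Set (Fin n → M)) [Group G] {H : Type z} [Group H]
    [TopologicalSpace H] [IsTopologicalGroup H] [CompactSpace H] [T2Space H] [MeasurableSpace H]
    [BorelSpace H] (π : G →* H) : Prop :=
  IsCompactlyDominated L G (normalizedHaar H) π

end Domination

end CompactDomination

open CompactDomination

/-! The measure is `μ(Y) = m(π(Y))`, with `m` Haar measure. Saturation makes `π(Y)` closed
(`IsDefinableMap.isClosed_image`), and `π(Y) ∩ π(Z)` exceeds `π(Y ∩ Z)` only by a null set of fibres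
that `Y` splits; hence additivity. Invariance on both sides comes from that of `m`, a compact group
being unimodular.

Smoothness and uniqueness both follow from `ν(Y) ≤ m(U)` for each open `U ⊇ π(Y)`: outer regularity
gives `ν ≤ μ`, and complements give equality. For smoothness, saturation puts a set `Z`, definable
over a fixed small set, between `Y` and `π⁻¹(U)`, and `ν(Y) ≤ ν(Z) = μ(Z) ≤ m(U)`. For
left-invariant `ν`, some convex combination of indicators of translates of `π(Y)` is at most `m(U)`
everywhere (`exists_sum_indicator_translate_le`). Pulled back to `G` and integrated against `ν`, it
gives `ν(Y) ≤ m(U)`. -/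

namespace CompactDomination

/-! ### Saturation and type-definable sets -/

section Saturation

variable {L : FirstOrder.Language.{u, v}} {M : Type w} [L.Structure M]

theorem IsSmall.union {A B : Set M} (hM : Cardinal.aleph0 ≤ Cardinal.mk M)
    (hA : IsSmall A) (hB : IsSmall B) : IsSmall (A ∪ B) :=
  (Cardinal.mk_union_le A B).trans_lt (Cardinal.add_lt_of_lt hM hA hB)

theorem IsSmall.of_finite {A : Set M} (hM : Cardinal.aleph0 ≤ Cardinal.mk M) (hA : A.Finite) :
    IsSmall A :=
  (Cardinal.mk_lt_aleph0_iff.2 hA.to_subtype).trans_le hM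

theorem TypeDefinableOver.mono {A B : Set M} {α : Type*} {X : Set (α → M)}
    (hX : TypeDefinableOver L A X) (h : A ⊆ B) : TypeDefinableOver L B X := by
  obtain ⟨F, hF, rfl⟩ := hX
  exact ⟨F, fun Y hY => (hF Y hY).mono h, rfl⟩

theorem TypeDefinableOver.inter {A : Set M} {α : Type*} {X Y : Set (α → M)}
    (hX : TypeDefinableOver L A X) (hY : TypeDefinableOver L A Y) :
    TypeDefinableOver L A (X ∩ Y) := by
  obtain ⟨F, hF, rfl⟩ := hX
  obtain ⟨E, hE, rfl⟩ := hY
  refine ⟨F ∪ E, ?_, (Set.sInter_union F E).symm⟩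
  rintro Z (hZ | hZ)
  exacts [hF Z hZ, hE Z hZ]

theorem _root_.Set.Definable.typeDefinableOver {A : Set M} {α : Type*} {X : Set (α → M)}
    (hX : A.Definable L X) : TypeDefinableOver L A X :=
  ⟨{X}, by simpa using hX, by simp⟩

theorem definable_sInter_of_finite {A : Set M} {α : Type*} {F : Set (Set (α → M))}
    (hF : F.Finite) (h : ∀ Y ∈ F, A.Definable L Y) : A.Definable L (⋂₀ F) := by
  have := hF.to_subtype
  rw [Set.sInter_eq_iInter]
  exact Set.definable_iInter_of_finite fun i => h i i.2

theorem definable_setOf_apply_eq {A : Set M} {α : Type*} (i : α) {a : M} (ha : a ∈ A) :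
    A.Definable L {t : α → M | t i = a} :=
  Set.Definable.preimage_comp (fun _ : Fin 1 => i) (Set.Definable.singleton_of_mem L ha)

theorem definable_setOf_comp_eq {A : Set M} {α β : Type*} [Finite β] (f : β → α) {a : β → M}
    (ha : ∀ i, a i ∈ A) : A.Definable L {t : α → M | t ∘ f = a} := by
  have : {t : α → M | t ∘ f = a} = ⋂ i, {t : α → M | t (f i) = a i} := by
    ext t
    simp [funext_iff]
  rw [this]
  exact Set.definable_iInter_of_finite fun i => definable_setOf_apply_eq (f i) (ha i)

/-- The family `F` has the finite intersection property. -/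
def HasFIP {β : Type*} (F : Set (Set β)) : Prop :=
  ∀ F₀ ⊆ F, F₀.Finite → (⋂₀ F₀).Nonempty

/-- A finitely satisfiable family of sets definable over a small set stays finitely satisfiable
after the value of one coordinate is prescribed suitably. -/
theorem IsSaturated.exists_hasFIP_insert (hM : IsSaturated L M) {A : Set M} (hA : IsSmall A)
    {α : Type*} [Finite α] {F : Set (Set (α → M))} (hF : ∀ Y ∈ F, A.Definable L Y)
    (hfip : HasFIP F) (i : α) : ∃ a, HasFIP (insert {t | t i = a} F) := by
  -- One-variable saturation is applied to the projections to coordinate `i` of all finite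
  -- intersections from `F`.
  have key := hM A hA
    ((fun F₀ : Set (Set (α → M)) => (fun t : α → M => t i) '' (⋂₀ F₀)) ''
      {F₀ | F₀ ⊆ F ∧ F₀.Finite}) ?_ ?_
  · obtain ⟨a, ha⟩ := key
    refine ⟨a, fun F₀ hF₀ hfin => ?_⟩
    obtain ⟨t, ht, hta⟩ := ha _ ⟨F₀ \ {{t : α → M | t i = a}},
      ⟨fun Y hY => (hF₀ hY.1).resolve_left hY.2, hfin.sdiff⟩, rfl⟩
    refine ⟨t, fun Y hY => ?_⟩
    by_cases h : Y = {t | t i = a}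
    · rw [h]
      exact hta
    · exact ht Y ⟨hY, h⟩
  · rintro _ ⟨F₀, ⟨hF₀, hfin⟩, rfl⟩
    have h := (definable_sInter_of_finite hfin fun Y hY => hF Y (hF₀ hY)).image_comp
      (fun _ : Fin 1 => i)
    refine (congrArg (A.Definable L) (Set.ext fun x => ?_)).mp h
    constructor
    · rintro ⟨t, ht, rfl⟩
      exact ⟨t, ht, rfl⟩
    · rintro ⟨t, ht, hx⟩
      refine ⟨t, ht, funext fun j => ?_⟩
      rw [Subsingleton.elim j 0]
      exact hx
  · intro E hE
    choose! c hc hcE using fun Y (hY : Y ∈ (E : Set (Set M))) => hE hY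
    obtain ⟨t, ht⟩ := hfip (⋃ Y ∈ E, c Y)
      (Set.iUnion₂_subset fun Y hY => (hc Y hY).1)
      (E.finite_toSet.biUnion fun Y hY => (hc Y hY).2)
    refine ⟨t i, fun Y hY => ?_⟩
    rw [← hcE Y hY]
    exact ⟨t, fun Z hZ => ht Z (Set.mem_biUnion hY hZ), rfl⟩

/-- Saturation for types in finitely many variables. -/
theorem IsSaturated.sInter_nonempty (hinf : Cardinal.aleph0 ≤ Cardinal.mk M)
    (hM : IsSaturated L M) {A : Set M} (hA : IsSmall A) {α : Type*} [Finite α]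
    {F : Set (Set (α → M))} (hF : ∀ Y ∈ F, A.Definable L Y) (hfip : HasFIP F) :
    (⋂₀ F).Nonempty := by
  classical
  cases nonempty_fintype α
  have key : ∀ s : Finset α, ∃ a : α → M,
      HasFIP (F ∪ (fun i => {t : α → M | t i = a i}) '' (s : Set α)) := by
    intro s
    induction s using Finset.induction_on with
    | empty =>
      obtain ⟨a, -⟩ := hfip ∅ (Set.empty_subset _) Set.finite_empty
      exact ⟨a, by simpa using hfip⟩
    | insert i s hi ih =>
      obtain ⟨a, ha⟩ := ih
      -- The values already chosen become parameters; they are finitely many, so the parameter set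
      -- stays small.
      obtain ⟨b, hb⟩ := hM.exists_hasFIP_insert
        (hA.union hinf (IsSmall.of_finite hinf (Set.finite_range a)))
        (F := F ∪ (fun i => {t : α → M | t i = a i}) '' (s : Set α)) (by
          rintro _ (hY | ⟨j, -, rfl⟩)
          · exact (hF _ hY).mono Set.subset_union_left
          · exact definable_setOf_apply_eq j (Or.inr (Set.mem_range_self j))) ha i
      refine ⟨Function.update a i b, ?_⟩
      have himg : (fun j => {t : α → M | t j = Function.update a i b j}) '' (s : Set α) =
          (fun j => {t : α → M | t j = a j}) '' (s : Set α) :=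
        Set.image_congr fun j hj => by
          rw [Function.update_of_ne (by rintro rfl; exact hi hj)]
      rw [Finset.coe_insert, Set.image_insert_eq, himg, Function.update_self, Set.union_insert]
      exact hb
  obtain ⟨a, ha⟩ := key Finset.univ
  refine ⟨a, fun Y hY => ?_⟩
  -- Prescribing all coordinates leaves `a` as the only candidate, so `a` lies in each `Y`
  -- separately.
  obtain ⟨t, ht⟩ := ha (insert Y ((fun i => {t : α → M | t i = a i}) '' Set.univ))
    (by
      rw [Finset.coe_univ]
      exact Set.insert_subset (Or.inl hY) Set.subset_union_right)
    ((Set.finite_univ.image _).insert _)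
  have hta : t = a := funext fun i => ht _ (Or.inr ⟨i, trivial, rfl⟩)
  exact hta ▸ ht Y (Or.inl rfl)

/-- Disjoint sets that are type-definable over a small set can be separated by a definable set. -/
theorem IsSaturated.exists_definable_separation (hinf : Cardinal.aleph0 ≤ Cardinal.mk M)
    (hM : IsSaturated L M) {A : Set M} (hA : IsSmall A) {α : Type*} [Finite α]
    {X Y : Set (α → M)} (hX : TypeDefinableOver L A X) (hY : TypeDefinableOver L A Y)
    (hXY : Disjoint X Y) : ∃ D, A.Definable L D ∧ X ⊆ D ∧ Disjoint D Y := by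
  obtain ⟨F, hF, rfl⟩ := hX
  obtain ⟨E, hE, rfl⟩ := hY
  by_contra! hcon
  have hne : (⋂₀ (F ∪ E)).Nonempty := by
    refine hM.sInter_nonempty hinf hA (A := A) ?_ fun F₀ hF₀ hfin => ?_
    · rintro Z (hZ | hZ)
      exacts [hF Z hZ, hE Z hZ]
    -- This definable set contains `X`, so it would have to meet `Y`; a common point lies in every
    -- member of `F₀`.
    · have := hcon (⋂₀ (F₀ ∩ F))
        (definable_sInter_of_finite (hfin.inter_of_left F) fun Z hZ => hF Z hZ.2)
        (Set.sInter_subset_sInter Set.inter_subset_right)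
      obtain ⟨t, ht, ht'⟩ := Set.not_disjoint_iff.1 this
      refine ⟨t, fun Z hZ => ?_⟩
      rcases hF₀ hZ with h | h
      exacts [ht Z ⟨hZ, h⟩, ht' Z h]
  rw [Set.sInter_union] at hne
  exact Set.not_disjoint_iff_nonempty_inter.2 hne hXY

/-- In a saturated model, coordinate projections of type-definable sets are type-definable. -/
theorem IsSaturated.typeDefinableOver_image_comp (hinf : Cardinal.aleph0 ≤ Cardinal.mk M)
    (hM : IsSaturated L M) {A : Set M} (hA : IsSmall A) {α β : Type*} [Finite α] [Finite β]
    {X : Set (α → M)} (hX : TypeDefinableOver L A X) (f : β → α) :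
    TypeDefinableOver L A ((fun t : α → M => t ∘ f) '' X) := by
  obtain ⟨F, hF, rfl⟩ := hX
  refine ⟨(fun F₀ : Set (Set (α → M)) => (fun t : α → M => t ∘ f) '' (⋂₀ F₀)) ''
      {F₀ | F₀ ⊆ F ∧ F₀.Finite}, ?_, Set.Subset.antisymm ?_ fun z hz => ?_⟩
  · rintro _ ⟨F₀, ⟨hF₀, hfin⟩, rfl⟩
    exact (definable_sInter_of_finite hfin fun Y hY => hF Y (hF₀ hY)).image_comp f
  · rintro _ ⟨t, ht, rfl⟩ _ ⟨F₀, ⟨hF₀, -⟩, rfl⟩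
    exact ⟨t, fun Y hY => ht Y (hF₀ hY), rfl⟩
  -- A preimage of `z` in all of `F` realizes a type over `A` and the finitely many coordinates of
  -- `z`.
  · obtain ⟨t, ht⟩ := hM.sInter_nonempty hinf
      (hA.union hinf (IsSmall.of_finite hinf (Set.finite_range z)))
      (F := insert {t | t ∘ f = z} F) (by
        rintro _ (rfl | hY)
        · exact definable_setOf_comp_eq f fun i => Or.inr (Set.mem_range_self i)
        · exact (hF _ hY).mono Set.subset_union_left) (by
        intro F₀ hF₀ hfin
        obtain ⟨t, ht, htz⟩ := hz _ ⟨F₀ \ {{t | t ∘ f = z}},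
          ⟨fun Y hY => (hF₀ hY.1).resolve_left hY.2, hfin.sdiff⟩, rfl⟩
        refine ⟨t, fun Y hY => ?_⟩
        by_cases h : Y = {t | t ∘ f = z}
        · rw [h]
          exact htz
        · exact ht Y ⟨hY, h⟩)
    exact ⟨t, fun Y hY => ht Y (Or.inr hY), ht _ (Or.inl rfl)⟩

/-- Every small set is contained in a small elementary substructure. -/
theorem IsLargeSaturated.exists_elementarySubstructure (hM : IsLargeSaturated L M) {A : Set M}
    (hA : IsSmall A) :
    ∃ M₀ : L.ElementarySubstructure M, A ⊆ M₀ ∧ IsSmall (M₀ : Set M) := by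
  obtain ⟨κ, hκ, hκL⟩ := Cardinal.lt_lift_iff.1 hM.card_language_lt
  set c := max Cardinal.aleph0 (max (Cardinal.mk A) κ)
  have hcM : c < Cardinal.mk M := max_lt hM.aleph0_lt (max_lt hA hκ)
  obtain ⟨S, hAS, hS⟩ := FirstOrder.Language.exists_elementarySubstructure_card_eq L A c
    (le_max_left _ _)
    (Cardinal.lift_le.2 ((le_max_left _ _).trans (le_max_right _ _)))
    (by
      rw [← hκL]
      exact Cardinal.lift_le.2 ((le_max_right _ _).trans (le_max_right _ _)))
    (Cardinal.lift_le.2 hcM.le)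
  refine ⟨S, hAS, ?_⟩
  rw [Cardinal.lift_inj] at hS
  exact hS.trans_lt hcM

end Saturation

end CompactDomination

namespace CompactDomination

open MeasureTheory

/-! ### Averaging translates in a compact group -/

section Haar

variable {H : Type*} [Group H] [TopologicalSpace H] [IsTopologicalGroup H]
  [MeasurableSpace H] [BorelSpace H]

/-- A Haar probability measure is right-invariant. -/
theorem isMulRightInvariant_of_isProbabilityMeasure [LocallyCompactSpace H] (m : Measure H)
    [m.IsHaarMeasure] [IsProbabilityMeasure m] : m.IsMulRightInvariant := by
  refine ⟨fun g => ?_⟩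
  have : IsProbabilityMeasure (m.map (· * g)) :=
    Measure.isProbabilityMeasure_map (measurable_mul_const g).aemeasurable
  exact Measure.isHaarMeasure_eq_of_isProbabilityMeasure _ _

/-- A Haar probability measure is invariant under inversion. -/
theorem isInvInvariant_of_isProbabilityMeasure [LocallyCompactSpace H] (m : Measure H)
    [m.IsHaarMeasure] [IsProbabilityMeasure m] : m.IsInvInvariant := by
  have := isMulRightInvariant_of_isProbabilityMeasure m
  have : IsProbabilityMeasure m.inv :=
    Measure.isProbabilityMeasure_map measurable_inv.aemeasurable
  -- Inversion turns right-invariance of `m` into left-invariance of `m.inv`.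
  have : m.inv.IsHaarMeasure := {}
  exact ⟨Measure.isHaarMeasure_eq_of_isProbabilityMeasure _ _⟩

/-- A compact group is a finite disjoint union of measurable sets, each small with respect to a
given neighborhood of the identity. -/
theorem exists_measurable_partition [CompactSpace H] {V : Set H} (hV : V ∈ nhds (1 : H)) :
    ∃ (k : ℕ) (γ : Fin k → H) (B : Fin k → Set H), (∀ i, MeasurableSet (B i)) ∧
      Pairwise (Function.onFun Disjoint B) ∧ ⋃ i, B i = Set.univ ∧
      ∀ i, ∀ b ∈ B i, b⁻¹ * γ i ∈ V := by
  let C : H → Set H := fun γ => {b | b⁻¹ * γ ∈ interior V}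
  have hC : ∀ γ, IsOpen (C γ) := fun γ =>
    isOpen_interior.preimage (continuous_inv.mul continuous_const)
  obtain ⟨t, ht⟩ := isCompact_univ.elim_finite_subcover C hC fun γ _ =>
    Set.mem_iUnion.2 ⟨γ, by simpa [C] using mem_interior_iff_mem_nhds.2 hV⟩
  let γ : Fin t.card → H := fun i => t.equivFin.symm i
  refine ⟨t.card, γ, disjointed (C ∘ γ), fun i => ?_, disjoint_disjointed _, ?_, fun i b hb => ?_⟩
  · exact disjointedRec (fun _ j ht => ht.diff (hC (γ j)).measurableSet) (hC (γ i)).measurableSet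
  · rw [iUnion_disjointed, Set.eq_univ_iff_forall]
    intro b
    obtain ⟨g, hg, hb⟩ := Set.mem_iUnion₂.1 (ht (Set.mem_univ b))
    exact Set.mem_iUnion.2 ⟨t.equivFin ⟨g, hg⟩, by simpa [γ] using hb⟩
  · exact interior_subset (disjointed_subset (C ∘ γ) i hb)

/-- If `U` is an open neighborhood of a compact subset `K` of a compact group, then some convex
combination of the indicator functions of translates of `K` is bounded by the measure of `U`. -/
theorem exists_sum_indicator_translate_le [CompactSpace H] (m : Measure H) [m.IsHaarMeasure]
    [IsProbabilityMeasure m] {K U : Set H} (hK : IsCompact K) (hU : IsOpen U) (hKU : K ⊆ U) :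
    ∃ (k : ℕ) (γ : Fin k → H) (c : Fin k → ℝ), (∀ i, 0 ≤ c i) ∧ ∑ i, c i = 1 ∧
      ∀ h, ∑ i, c i * {x | (γ i)⁻¹ * x ∈ K}.indicator 1 h ≤ m.real U := by
  have := isMulRightInvariant_of_isProbabilityMeasure m
  have := isInvInvariant_of_isProbabilityMeasure m
  obtain ⟨V, hV, hVK⟩ := compact_open_separated_mul_left hK hU hKU
  obtain ⟨k, γ, B, hB, hdisj, hcov, hBV⟩ := exists_measurable_partition hV
  refine ⟨k, γ, fun i => m.real (B i), fun i => measureReal_nonneg, ?_, fun h => ?_⟩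
  · rw [← measureReal_iUnion_fintype hdisj hB, hcov, probReal_univ]
  -- The sum discretizes the integral over `b` of the indicator of `b * K` at `h`; `S` collects the
  -- `b` with `h ∈ b * U`.
  · let S : Set H := {b | b⁻¹ * h ∈ U}
    have hS : MeasurableSet S :=
      (hU.preimage (continuous_inv.mul continuous_const)).measurableSet
    have hSU : m.real S = m.real U := by
      have : S = (fun b => b⁻¹) ⁻¹' ((fun b => b * h) ⁻¹' U) := rfl
      rw [Measure.real, this, Measure.measure_preimage_inv, measure_preimage_mul_right, Measure.real]
    calc ∑ i, m.real (B i) * {x | (γ i)⁻¹ * x ∈ K}.indicator 1 h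
        ≤ ∑ i, m.real (B i ∩ S) := by
          refine Finset.sum_le_sum fun i _ => ?_
          by_cases hi : (γ i)⁻¹ * h ∈ K
          -- Here `b⁻¹ * h = (b⁻¹ * γ i) * ((γ i)⁻¹ * h)` lies in `V * K ⊆ U`.
          · have hsub : B i ⊆ S := fun b hb => hVK ⟨_, hBV i b hb, _, hi, by group⟩
            rw [Set.indicator_of_mem (by exact hi), Pi.one_apply, mul_one,
              Set.inter_eq_left.2 hsub]
          · rw [Set.indicator_of_notMem (by exact hi), mul_zero]
            exact measureReal_nonneg
      _ = m.real S := by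
          rw [← measureReal_iUnion_fintype
            (fun i j hij => (hdisj hij).mono Set.inter_subset_left Set.inter_subset_left)
            (fun i => (hB i).inter hS), ← Set.iUnion_inter, hcov, Set.univ_inter]
      _ = m.real U := hSU

end Haar

end CompactDomination

namespace CompactDomination

open MeasureTheory

/-! ### Integration against Keisler measures -/

section Keisler

variable {L : FirstOrder.Language.{u, v}} {M : Type w} [L.Structure M] {n : ℕ}
  {X : Set (Fin n → M)} {A : Set M}

theorem RelDefinable.compl {Y : Set X} (hY : RelDefinable L A Y) : RelDefinable L A Yᶜ := by
  obtain ⟨D, hD, rfl⟩ := hY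
  exact ⟨Dᶜ, hD.compl, rfl⟩

open Classical in
/-- The value of a Keisler measure at a set, with value `0` outside its domain. -/
noncomputable def KeislerMeasure.eval (ν : KeislerMeasure L X A) (Y : Set X) : ℝ :=
  if h : RelDefinable L A Y then ν.toFun ⟨Y, h⟩ else 0

theorem KeislerMeasure.eval_eq (ν : KeislerMeasure L X A) {Y : Set X} (hY : RelDefinable L A Y) :
    ν.eval Y = ν.toFun ⟨Y, hY⟩ :=
  dif_pos hY

theorem KeislerMeasure.eval_nonneg (ν : KeislerMeasure L X A) (Y : Set X) : 0 ≤ ν.eval Y := by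
  unfold KeislerMeasure.eval
  split_ifs
  exacts [(ν.mem_Icc _).1, le_rfl]

theorem KeislerMeasure.eval_empty (ν : KeislerMeasure L X A) : ν.eval ∅ = 0 :=
  (ν.eval_eq (RelDefinable.empty A)).trans ν.empty

theorem KeislerMeasure.eval_univ (ν : KeislerMeasure L X A) : ν.eval Set.univ = 1 :=
  (ν.eval_eq (RelDefinable.univ A)).trans ν.univ

theorem KeislerMeasure.eval_union_add_inter (ν : KeislerMeasure L X A) {Y Z : Set X}
    (hY : RelDefinable L A Y) (hZ : RelDefinable L A Z) :
    ν.eval (Y ∪ Z) + ν.eval (Y ∩ Z) = ν.eval Y + ν.eval Z := by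
  rw [ν.eval_eq hY, ν.eval_eq hZ, ν.eval_eq (hY.union hZ), ν.eval_eq (hY.inter hZ),
    ν.union ⟨Y, hY⟩ ⟨Z, hZ⟩]
  ring

theorem KeislerMeasure.eval_inter_add_inter_compl (ν : KeislerMeasure L X A) {Y Z : Set X}
    (hY : RelDefinable L A Y) (hZ : RelDefinable L A Z) :
    ν.eval (Y ∩ Z) + ν.eval (Y ∩ Zᶜ) = ν.eval Y := by
  have h := ν.eval_union_add_inter (hY.inter hZ) (hY.inter hZ.compl)
  rw [Set.inter_union_compl, ← Set.inter_inter_distrib_left, Set.inter_compl_self,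
    Set.inter_empty, ν.eval_empty, add_zero] at h
  exact h.symm

theorem KeislerMeasure.eval_mono (ν : KeislerMeasure L X A) {Y Z : Set X}
    (hY : RelDefinable L A Y) (hZ : RelDefinable L A Z) (h : Y ⊆ Z) : ν.eval Y ≤ ν.eval Z := by
  have := ν.eval_inter_add_inter_compl hZ hY
  rw [Set.inter_eq_right.2 h] at this
  linarith [ν.eval_nonneg (Z ∩ Yᶜ)]

theorem KeislerMeasure.eval_add_eval_compl (ν : KeislerMeasure L X A) {Y : Set X}
    (hY : RelDefinable L A Y) : ν.eval Y + ν.eval Yᶜ = 1 := by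
  have := ν.eval_inter_add_inter_compl (RelDefinable.univ A) hY
  rwa [Set.univ_inter, Set.univ_inter, ν.eval_univ] at this

/-- Both measures have total mass one, so the inequality for complements is the reverse inequality.
-/
theorem KeislerMeasure.eq_of_eval_le {ν μ : KeislerMeasure L X A}
    (h : ∀ Y, RelDefinable L A Y → ν.eval Y ≤ μ.eval Y) : ν = μ := by
  have heq : ν.toFun = μ.toFun := by
    funext Y
    rw [← ν.eval_eq Y.2, ← μ.eval_eq Y.2]
    linarith [h Y.1 Y.2, h _ Y.2.compl, ν.eval_add_eval_compl Y.2, μ.eval_add_eval_compl Y.2]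
  cases ν
  cases μ
  cases heq
  rfl

/-- Integration of simple functions against a Keisler measure is monotone. -/
theorem KeislerMeasure.sum_mul_eval_inter_le (ν : KeislerMeasure L X A) {ι : Type*}
    (s : Finset ι) (c : ι → ℝ) {Y : ι → Set X} (hY : ∀ i, RelDefinable L A (Y i))
    {Z : Set X} (hZ : RelDefinable L A Z) {t : ℝ}
    (h : ∀ x ∈ Z, ∑ i ∈ s, c i * (Y i).indicator 1 x ≤ t) :
    ∑ i ∈ s, c i * ν.eval (Y i ∩ Z) ≤ t * ν.eval Z := by
  classical
  induction s using Finset.induction_on generalizing Z t with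
  | empty =>
    -- For empty `Z` the bound `t` may be negative, but it is multiplied by zero.
    rcases Z.eq_empty_or_nonempty with rfl | ⟨x, hx⟩
    · simp [ν.eval_empty]
    · simpa using mul_nonneg (by simpa using h x hx) (ν.eval_nonneg Z)
  | insert j s hj ih =>
    -- Cutting `Z` along `Y j` makes the new term constant on each piece: `c j` inside, `0` outside.
    have h₁ := ih (hZ.inter (hY j)) (t := t - c j) fun x hx => by
      have := h x hx.1
      rw [Finset.sum_insert hj, Set.indicator_of_mem hx.2, Pi.one_apply] at this
      linarith
    have h₂ := ih (hZ.inter (hY j).compl) (t := t) fun x hx => by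
      have := h x hx.1
      rw [Finset.sum_insert hj, Set.indicator_of_notMem hx.2] at this
      linarith
    have hsum : ∑ i ∈ s, c i * ν.eval (Y i ∩ Z) =
        ∑ i ∈ s, c i * ν.eval (Y i ∩ (Z ∩ Y j)) + ∑ i ∈ s, c i * ν.eval (Y i ∩ (Z ∩ (Y j)ᶜ)) := by
      rw [← Finset.sum_add_distrib]
      refine Finset.sum_congr rfl fun i _ => ?_
      rw [← mul_add, ← Set.inter_assoc, ← Set.inter_assoc,
        ν.eval_inter_add_inter_compl ((hY i).inter hZ) (hY j)]
    rw [Finset.sum_insert hj, hsum, ← ν.eval_inter_add_inter_compl hZ (hY j),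
      Set.inter_comm (Y j) Z]
    linarith

theorem KeislerMeasure.sum_mul_eval_le (ν : KeislerMeasure L X A) {ι : Type*}
    (s : Finset ι) (c : ι → ℝ) {Y : ι → Set X} (hY : ∀ i, RelDefinable L A (Y i)) {t : ℝ}
    (h : ∀ x, ∑ i ∈ s, c i * (Y i).indicator 1 x ≤ t) :
    ∑ i ∈ s, c i * ν.eval (Y i) ≤ t := by
  simpa [ν.eval_univ] using
    ν.sum_mul_eval_inter_le s c hY (RelDefinable.univ A) fun x _ => h x

end Keisler

/-! ### Definability of translates -/

section Translates

variable {L : FirstOrder.Language.{u, v}} {M : Type w} [L.Structure M] {n : ℕ}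
  {G : Set (Fin n → M)} [Group G]

/-- Exhibits a translate as a projection, so that saturation makes it type-definable even though
multiplication need not be definable. -/
theorem image_val_translate (g : G) (D : Set (Fin n → M)) :
    (Subtype.val '' ((fun x => g * x) '' (Subtype.val ⁻¹' D : Set G)) : Set (Fin n → M)) =
      (fun t : Fin n ⊕ Fin n ⊕ Fin n → M => t ∘ (Sum.inr ∘ Sum.inr)) ''
        (mulGraph G ∩ ({t | t ∘ Sum.inl = g.val} ∩
          (fun t => t ∘ (Sum.inr ∘ Sum.inl)) ⁻¹' D)) := by
  ext z
  constructor
  · rintro ⟨_, ⟨y, hy, rfl⟩, rfl⟩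
    exact ⟨_, ⟨⟨g, y, rfl⟩, rfl, hy⟩, rfl⟩
  · rintro ⟨_, ⟨⟨x, y, rfl⟩, hx, hy⟩, rfl⟩
    have hxg : x = g := Subtype.ext hx
    subst hxg
    exact ⟨_, ⟨y, hy, rfl⟩, rfl⟩

/-- Left translates of relatively definable subsets of a type-definable group are relatively
definable. -/
theorem IsTypeDefinableGroup.relDefinable_translate (hinf : Cardinal.aleph0 ≤ Cardinal.mk M)
    (hM : IsSaturated L M) (hG : IsTypeDefinableGroup L G) (g : G) {Y : Set G}
    (hY : RelDefinable L Set.univ Y) :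
    RelDefinable L Set.univ ((fun x => g * x) '' Y) := by
  obtain ⟨A, hA, -, hmul⟩ := hG
  obtain ⟨D, hD, rfl⟩ := hY
  obtain ⟨B, -, hB⟩ := Set.definable_iff_finitely_definable.1 hD
  set A' : Set M := A ∪ (B ∪ Set.range g.val)
  have hsmall : IsSmall A' := hA.union hinf
    (IsSmall.of_finite hinf (B.finite_toSet.union (Set.finite_range _)))
  have key : ∀ E : Set (Fin n → M), A'.Definable L E → TypeDefinableOver L A'
      (Subtype.val '' ((fun x => g * x) '' (Subtype.val ⁻¹' E : Set G))) := by
    intro E hE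
    rw [image_val_translate]
    refine hM.typeDefinableOver_image_comp hinf hsmall
      ((hmul.mono Set.subset_union_left).inter (Set.Definable.typeDefinableOver ?_)) _
    refine Set.Definable.inter ?_ (hE.preimage_comp _)
    exact definable_setOf_comp_eq _ fun i => Or.inr (Or.inr (Set.mem_range_self i))
  have hD' : A'.Definable L D :=
    hB.mono (Set.subset_union_left.trans Set.subset_union_right)
  -- The translates of `D` and `Dᶜ` partition `G`, so a definable set separating them cuts out
  -- exactly the translate of `D`.
  obtain ⟨E, hE, hsub, hdisj⟩ := hM.exists_definable_separation hinf hsmall (key D hD')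
    (key Dᶜ hD'.compl) (by
      rw [Set.disjoint_image_iff Subtype.val_injective,
        Set.disjoint_image_iff (mul_right_injective g)]
      exact disjoint_compl_right.preimage _)
  refine ⟨E, hE.mono (Set.subset_univ _), Set.Subset.antisymm
    (fun z hz => hsub ⟨z, hz, rfl⟩) fun z hz => ?_⟩
  by_contra hcon
  refine Set.disjoint_left.1 hdisj hz ⟨z, ⟨g⁻¹ * z, fun h => hcon ⟨g⁻¹ * z, h, ?_⟩, ?_⟩, rfl⟩
  all_goals exact mul_inv_cancel_left g z

end Translates

/-! ### The measure of a compactly dominated set -/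

section Domination

variable {L : FirstOrder.Language.{u, v}} {M : Type w} [L.Structure M] {n : ℕ}
  {X : Set (Fin n → M)} {C : Type z} [TopologicalSpace C]

/-- A definable map to a regular Hausdorff space maps definable sets to closed sets. -/
theorem IsDefinableMap.isClosed_image [T3Space C] (hinf : Cardinal.aleph0 ≤ Cardinal.mk M)
    (hM : IsSaturated L M) {f : X → C} (hf : IsDefinableMap L f) {Y : Set X}
    (hY : RelDefinable L Set.univ Y) : IsClosed (f '' Y) := by
  obtain ⟨A, hA, hf⟩ := hf
  obtain ⟨D, hD, rfl⟩ := hY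
  obtain ⟨B, -, hB⟩ := Set.definable_iff_finitely_definable.1 hD
  refine isClosed_of_closure_subset fun c hc => ?_
  -- The type of a point of `D` whose image lies in every closed neighborhood of `c`. It is finitely
  -- satisfiable as `c` is in the closure of `f '' Y`; by regularity a realization maps to `c`.
  let F : Set (Set (Fin n → M)) := {Z | (A ∪ B).Definable L Z ∧
    ∃ E ∈ nhds c, Subtype.val '' (f ⁻¹' E) ∩ D ⊆ Z}
  obtain ⟨t, ht⟩ : (⋂₀ F).Nonempty := by
    refine hM.sInter_nonempty hinf (hA.union hinf (IsSmall.of_finite hinf B.finite_toSet))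
      (fun Z hZ => hZ.1) fun F₀ hF₀ hfin => ?_
    choose! E hE hEZ using fun Z (hZ : Z ∈ F₀) => (hF₀ hZ).2
    obtain ⟨_, hx, y, hy, rfl⟩ := mem_closure_iff_nhds.1 hc _ ((Filter.biInter_mem hfin).2 hE)
    exact ⟨y, fun Z hZ => hEZ Z hZ ⟨⟨y, Set.mem_iInter₂.1 hx Z hZ, rfl⟩, hy⟩⟩
  have htD : t ∈ D := ht D ⟨hB.mono Set.subset_union_right, Set.univ, Filter.univ_mem,
    Set.inter_subset_right⟩
  have htE : ∀ E ∈ nhds c, IsClosed E → t ∈ Subtype.val '' (f ⁻¹' E) := by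
    intro E hE hEc
    obtain ⟨F', hF', heq⟩ := hf E hEc
    rw [heq]
    exact fun Z hZ => ht Z ⟨(hF' Z hZ).mono Set.subset_union_left, E, hE,
      Set.inter_subset_left.trans (heq ▸ Set.sInter_subset_of_mem hZ)⟩
  obtain ⟨x, -, rfl⟩ := htE Set.univ Filter.univ_mem isClosed_univ
  refine ⟨x, htD, ?_⟩
  by_contra hne
  obtain ⟨E, ⟨hE, hEc⟩, hsub⟩ := (closed_nhds_basis c).mem_iff.1
    (isOpen_compl_singleton.mem_nhds (show c ∈ ({f x}ᶜ : Set C) from Ne.symm hne))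
  obtain ⟨y, hy, hyx⟩ := htE E hE hEc
  rw [Subtype.ext hyx] at hy
  exact hsub hy rfl

theorem exists_isOpen_measureReal_le_add [MeasurableSpace C] (m : Measure C) [IsFiniteMeasure m] [m.OuterRegular]
    (K : Set C) {ε : ℝ} (hε : 0 < ε) : ∃ U ⊇ K, IsOpen U ∧ m.real U ≤ m.real K + ε := by
  obtain ⟨U, hKU, hU, hlt⟩ := K.exists_isOpen_lt_add (measure_ne_top m _)
    (ENNReal.ofReal_pos.2 hε).ne'
  refine ⟨U, hKU, hU, ?_⟩
  have := ENNReal.toReal_mono (by finiteness) hlt.le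
  rwa [ENNReal.toReal_add (measure_ne_top _ _) ENNReal.ofReal_ne_top,
    ENNReal.toReal_ofReal hε.le] at this

variable [CompactSpace C] [T2Space C] [MeasurableSpace C] [BorelSpace C] {m : Measure C}
  [IsProbabilityMeasure m] {f : X → C}

/-- The Keisler measure `Y ↦ m (f Y)` of a compactly dominated set. -/
noncomputable def IsCompactlyDominated.measure (hM : IsLargeSaturated L M)
    (hf : IsCompactlyDominated L X m f) : GlobalKeislerMeasure L X where
  toFun Y := m.real (f '' Y.1)
  mem_Icc Y := ⟨measureReal_nonneg, measureReal_le_one⟩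
  empty := by simp
  univ := by rw [Set.image_univ_of_surjective hf.surjective, probReal_univ]
  union Y Z := by
    have hZ : MeasurableSet (f '' Z.1) :=
      (hf.definable.isClosed_image hM.aleph0_lt.le hM.saturated Z.2).measurableSet
    have hinter : m.real (f '' (Y.1 ∩ Z.1)) = m.real (f '' Y.1 ∩ f '' Z.1) := by
      refine le_antisymm (measureReal_mono (Set.image_inter_subset f Y.1 Z.1)) ?_
      have hsub : f '' Y.1 ∩ f '' Z.1 ⊆ f '' (Y.1 ∩ Z.1) ∪
          {c | (f ⁻¹' {c} ∩ Y.1).Nonempty ∧ (f ⁻¹' {c} ∩ Y.1ᶜ).Nonempty} := by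
        rintro c ⟨⟨y, hy, hyc⟩, z, hz, hzc⟩
        -- If `z ∉ Y`, the fibre over `c` contains `y ∈ Y` and `z ∉ Y`, so `c` is in the null set.
        by_cases h : z ∈ Y.1
        exacts [Or.inl ⟨z, ⟨h, hz⟩, hzc⟩, Or.inr ⟨⟨y, hyc, hy⟩, z, hzc, h⟩]
      refine (measureReal_mono hsub).trans ((measureReal_union_le _ _).trans ?_)
      rw [Measure.real_def m {c | _}, hf.null Y.1 Y.2, ENNReal.toReal_zero, add_zero]
    rw [Set.image_union, hinter, ← measureReal_union_add_inter hZ]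
    ring

theorem IsCompactlyDominated.eval_measure (hM : IsLargeSaturated L M)
    (hf : IsCompactlyDominated L X m f) {Y : Set X} (hY : RelDefinable L Set.univ Y) :
    (hf.measure hM).eval Y = m.real (f '' Y) :=
  KeislerMeasure.eval_eq _ hY

theorem IsCompactlyDominated.measure_isSmooth [m.OuterRegular] (hM : IsLargeSaturated L M)
    (hf : IsCompactlyDominated L X m f) : (hf.measure hM).IsSmooth := by
  have hcl := fun Y hY =>
    hf.definable.isClosed_image hM.aleph0_lt.le hM.saturated (Y := Y) hY
  obtain ⟨A, hA, hfA⟩ := hf.definable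
  obtain ⟨M₀, hAM, hM₀⟩ := hM.exists_elementarySubstructure hA
  refine ⟨M₀, hM₀, ?_, fun ν hν => KeislerMeasure.eq_of_eval_le fun Y hY => ?_⟩
  · simpa using (hfA Set.univ isClosed_univ).mono hAM
  · refine le_of_forall_pos_le_add fun ε hε => ?_
    obtain ⟨U, hKU, hU, hmU⟩ := exists_isOpen_measureReal_le_add m (f '' Y) hε
    -- Both preimages are of closed sets, hence type-definable over the same `A` whatever the
    -- parameters of `Y`; this is why one `M₀` serves all `Y`.
    obtain ⟨D, hD, hsub, hdisj⟩ := hM.saturated.exists_definable_separation hM.aleph0_lt.le hA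
      (hfA _ (hcl Y hY)) (hfA _ hU.isClosed_compl) (by
        rw [Set.disjoint_image_iff Subtype.val_injective]
        exact (Set.disjoint_compl_right_iff_subset.2 hKU).preimage f)
    let Z : Set X := Subtype.val ⁻¹' D
    have hZ₀ : RelDefinable L (M₀ : Set M) Z := ⟨D, hD.mono hAM, rfl⟩
    have hZ := hZ₀.mono (Set.subset_univ _)
    have hZU : f '' Z ⊆ U := by
      rintro _ ⟨x, hx, rfl⟩
      by_contra hxU
      exact Set.disjoint_left.1 hdisj hx ⟨x, hxU, rfl⟩
    have hagree : ν.eval Z = (hf.measure hM).eval Z := by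
      rw [ν.eval_eq hZ, KeislerMeasure.eval_eq _ hZ]
      exact congrFun (congrArg KeislerMeasure.toFun hν) ⟨Z, hZ₀⟩
    calc ν.eval Y ≤ ν.eval Z :=
          ν.eval_mono hY hZ fun x hx => hsub ⟨x, ⟨x, hx, rfl⟩, rfl⟩
      _ = m.real (f '' Z) := by rw [hagree, hf.eval_measure hM hZ]
      _ ≤ m.real U := measureReal_mono hZU
      _ ≤ (hf.measure hM).eval Y + ε := by rwa [hf.eval_measure hM hY]

end Domination

/-! ### Invariance and uniqueness -/

section Group

variable {L : FirstOrder.Language.{u, v}} {M : Type w} [L.Structure M] {n : ℕ}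
  {G : Set (Fin n → M)} [Group G] {H : Type z} [Group H]
  [TopologicalSpace H] [IsTopologicalGroup H] [CompactSpace H] [T2Space H] [MeasurableSpace H]
  [BorelSpace H] {m : Measure H} [IsProbabilityMeasure m] [m.IsHaarMeasure] {π : G →* H}

theorem IsCompactlyDominated.measure_isLeftInvariant (hM : IsLargeSaturated L M)
    (hπ : IsCompactlyDominated L G m π) : (hπ.measure hM).IsLeftInvariant := by
  intro g Y Z hYZ
  have : π '' Z.1 = (fun h => (π g)⁻¹ * h) ⁻¹' (π '' Y.1) := by
    rw [hYZ]
    ext h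
    constructor
    · rintro ⟨_, ⟨y, hy, rfl⟩, rfl⟩
      exact ⟨y, hy, by simp⟩
    · rintro ⟨y, hy, hyh⟩
      exact ⟨g * y, ⟨y, hy, rfl⟩, by simp [hyh]⟩
  change m.real (π '' Z.1) = m.real (π '' Y.1)
  rw [this, Measure.real, measure_preimage_mul, Measure.real]

theorem IsCompactlyDominated.measure_isRightInvariant (hM : IsLargeSaturated L M)
    (hπ : IsCompactlyDominated L G m π) : (hπ.measure hM).IsRightInvariant := by
  have := isMulRightInvariant_of_isProbabilityMeasure m
  intro g Y Z hYZ
  have : π '' Z.1 = (fun h => h * (π g)⁻¹) ⁻¹' (π '' Y.1) := by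
    rw [hYZ]
    ext h
    constructor
    · rintro ⟨_, ⟨y, hy, rfl⟩, rfl⟩
      exact ⟨y, hy, by simp⟩
    · rintro ⟨y, hy, hyh⟩
      exact ⟨y * g, ⟨y, hy, rfl⟩, by simp [hyh]⟩
  change m.real (π '' Z.1) = m.real (π '' Y.1)
  rw [this, Measure.real, measure_preimage_mul_right, Measure.real]

/-- A left-invariant Keisler measure on a compactly dominated group is determined by the Haar
measure of the dominating group. -/
theorem IsCompactlyDominated.eq_measure_of_isLeftInvariant [m.OuterRegular]
    (hM : IsLargeSaturated L M) (hG : IsTypeDefinableGroup L G)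
    (hπ : IsCompactlyDominated L G m π) {ν : GlobalKeislerMeasure L G}
    (hν : ν.IsLeftInvariant) : ν = hπ.measure hM := by
  refine KeislerMeasure.eq_of_eval_le fun Y hY => ?_
  rw [hπ.eval_measure hM hY]
  refine le_of_forall_pos_le_add fun ε hε => ?_
  obtain ⟨U, hKU, hU, hmU⟩ := exists_isOpen_measureReal_le_add m (π '' Y) hε
  refine le_trans ?_ hmU
  obtain ⟨k, γ, c, hc, hsum, hle⟩ := exists_sum_indicator_translate_le m
    (hπ.definable.isClosed_image hM.aleph0_lt.le hM.saturated hY).isCompact hU hKU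
  choose g hg using fun i => hπ.surjective (γ i)
  have hgY := fun i => hG.relDefinable_translate hM.aleph0_lt.le hM.saturated (g i) hY
  have hinv : ∀ i, ν.eval ((fun x => g i * x) '' Y) = ν.eval Y := fun i => by
    rw [ν.eval_eq (hgY i), ν.eval_eq hY]
    exact hν (g i) ⟨Y, hY⟩ ⟨_, hgY i⟩ rfl
  calc ν.eval Y = ∑ i, c i * ν.eval ((fun x => g i * x) '' Y) := by
        simp_rw [hinv, ← Finset.sum_mul, hsum, one_mul]
    _ ≤ m.real U := by
        -- If `x` lies in `g i * Y`, then `π x` lies in `γ i * π(Y)`, so the bound on `H` passes to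
        -- `G` term by term.
        refine ν.sum_mul_eval_le _ c hgY fun x => le_trans ?_ (hle (π x))
        refine Finset.sum_le_sum fun i _ => mul_le_mul_of_nonneg_left ?_ (hc i)
        by_cases hx : x ∈ (fun x => g i * x) '' Y
        · have hxK : π x ∈ {h | (γ i)⁻¹ * h ∈ π '' Y} := by
            obtain ⟨y, hy, rfl⟩ := hx
            exact ⟨y, hy, by simp [hg]⟩
          rw [Set.indicator_of_mem hx, Set.indicator_of_mem hxK]
          rfl
        · rw [Set.indicator_of_notMem hx]
          exact Set.indicator_nonneg (fun _ _ => zero_le_one) _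

end Group

end CompactDomination

theorem theorem9p5 {L : FirstOrder.Language.{u, v}} {M : Type w} [L.Structure M]
    (hM : IsLargeSaturated L M)
    {n : ℕ} (G : Set (Fin n → M)) [Group G] (hG : IsTypeDefinableGroup L G)
    {H : Type z} [Group H] [TopologicalSpace H] [IsTopologicalGroup H] [CompactSpace H]
    [T2Space H] [MeasurableSpace H] [BorelSpace H]
    (π : G →* H) (hπ : IsCompactlyDominatedGroup L G π) :
    ∃ μ : GlobalKeislerMeasure L G,
      μ.IsLeftInvariant ∧
      (∀ ν : GlobalKeislerMeasure L G, ν.IsLeftInvariant → ν = μ) ∧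
      μ.IsRightInvariant ∧
      μ.IsSmooth := by
  have : (normalizedHaar H).IsHaarMeasure := MeasureTheory.Measure.isHaarMeasure_haarMeasure _
  have : (normalizedHaar H).Regular := MeasureTheory.Measure.regular_haarMeasure
  exact ⟨hπ.measure hM, hπ.measure_isLeftInvariant hM,
    fun ν hν => hπ.eq_measure_of_isLeftInvariant hM hG hν,
    hπ.measure_isRightInvariant hM, hπ.measure_isSmooth hM⟩
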